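/- Let $\psi$ be a positive measure on $[-1,1]$ whose support is infinite, and suppose that the integral $\int_{-1}^{1}(1-x^2)^{-1/2}\,d\psi(x)$ exists, i.e. is finite (the integrand being $+\infty$ at $x=\pm1$, so that in particular $\psi(\{1\})=\psi(\{-1\})=0$). Define functions $\widehat{\mathcal W}_m$ on $[-1,1]$ and real numbers $\widehat\rho_m,\widehat\beta_{m+1}$ ($m\ge 0$) and $\widehat\alpha_{m+1}$ ($m\ge 1$) recursively by $$\widehat{\mathcal W}_0(x)=1,\qquad \widehat{\mathcal W}_1(x)=x-\widehat\beta_1\sqrt{1-x^2},$$ $$\widehat{\mathcal W}_{m+1}(x)=\big[x-\widehat\beta_{m+1}\sqrt{1-x^2}\big]\widehat{\mathcal W}_m(x)-\widehat\alpha_{m+1}\widehat{\mathcal W}_{m-1}(x),\qquad m\ge 1,$$ where $$\widehat\rho_m=\int_{-1}^1\widehat{\mathcal W}_m^2(x)\sqrt{1-x^2}\,d\psi(x),\qquad \widehat\beta_{m+1}=\frac1{\widehat\rho_m}\int_{-1}^1 x\,\widehat{\mathcal W}_m^2(x)\,d\psi(x),\qquad m\ge 0,$$ $$\widehat\alpha_{m+1}=\frac1{\widehat\rho_{m-1}}\int_{-1}^1\big[x-\widehat\beta_{m+1}\sqrt{1-x^2}\big]\widehat{\mathcal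 W}_{m-1}(x)\,\widehat{\mathcal W}_m(x)\sqrt{1-x^2}\,d\psi(x),\qquad m\ge 1.$$ A sequence $\{a_n\}_{n\ge1}$ of real numbers is a positive chain sequence if it has a parameter sequence, i.e. a sequence $\{g_n\}_{n\ge0}$ with $0\le g_0<1$, $0<g_n<1$ for $n\ge1$, and $a_n=(1-g_{n-1})g_n$ for $n\ge1$. Its minimal parameter sequence is the parameter sequence with $g_0=0$ (it is termwise the smallest one), and its maximal parameter sequence is the parameter sequence that is termwise the largest one. Then: 1. $\{\widehat\alpha_{m+1}\}_{m\ge1}$ is a positive chain sequence. 2. It has a minimal parameter sequence and a maximal parameter sequence, and these two do not coincide. 3. The same numbers are the coefficients of the recurrence of the associated polynomials on the unit circle: there are complex polynomials $\widehat K_m$, $m\ge0$, with $e^{-im\theta/2}\widehat K_m(e^{i\theta})=2^m\,\widehat{\mathcal W}_m(\cos(\theta/2))$ for $0\le\theta\le2\pi$, and they satisfy $\widehat K_0(z)=1$, $\widehat K_1(z)=(1+i\widehat\beta_1)z+(1-i\widehat\beta_1)$ and $$\widehat K_{m+1}(z)=\big[(1+i\widehat\beta_{m+1})z+(1-i\widehat\beta_{m+1})\big]\widehat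 K_m(z)-4\widehat\alpha_{m+1}\,z\,\widehat K_{m-1}(z),\qquad m\ge1.$$ -/

import Mathlib

open MeasureTheory Set
open scoped ENNReal

noncomputable section

/-- `∫ V(x)² √(1-x²) dψ(x)`. The measure `ψ` is a measure on `ℝ` carried by `[-1, 1]`, so that
integrals over `ℝ` are integrals over `[-1, 1]`. -/
def rhoOf (ψ : Measure ℝ) (V : ℝ → ℝ) : ℝ :=
  ∫ x, V x ^ 2 * √(1 - x ^ 2) ∂ψ

/-- The coefficient `β` determined by the last function `V` that was constructed. -/
def betaOf (ψ : Measure ℝ) (V : ℝ → ℝ) : ℝ :=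
  1 / rhoOf ψ V * ∫ x, x * V x ^ 2 ∂ψ

/-- The coefficient `α` determined by the last two functions `U`, `V` that were constructed
(in that order). -/
def alphaOf (ψ : Measure ℝ) (U V : ℝ → ℝ) : ℝ :=
  1 / rhoOf ψ U * ∫ x, (x - betaOf ψ V * √(1 - x ^ 2)) * U x * V x * √(1 - x ^ 2) ∂ψ

/-- The normalized orthogonal functions `Ŵ_m`, given by the three term recurrence. -/
def What (ψ : Measure ℝ) : ℕ → ℝ → ℝ
  | 0 => fun _ => 1
  | 1 => fun x => x - betaOf ψ (What ψ 0) * √(1 - x ^ 2)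
  | m + 2 => fun x =>
      (x - betaOf ψ (What ψ (m + 1)) * √(1 - x ^ 2)) * What ψ (m + 1) x
        - alphaOf ψ (What ψ m) (What ψ (m + 1)) * What ψ m x

/-- `ρ̂_m`, for `m ≥ 0`. -/
def rhoHat (ψ : Measure ℝ) (m : ℕ) : ℝ := rhoOf ψ (What ψ m)

/-- `β̂_m`, meaningful for `m ≥ 1`. -/
def betaHat (ψ : Measure ℝ) (m : ℕ) : ℝ := betaOf ψ (What ψ (m - 1))

/-- `α̂_m`, meaningful for `m ≥ 2`. -/
def alphaHat (ψ : Measure ℝ) (m : ℕ) : ℝ := alphaOf ψ (What ψ (m - 2)) (What ψ (m - 1))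

theorem What_zero (ψ : Measure ℝ) (x : ℝ) : What ψ 0 x = 1 := by
  simp only [What]

theorem What_one (ψ : Measure ℝ) (x : ℝ) :
    What ψ 1 x = x - betaHat ψ 1 * √(1 - x ^ 2) := by
  simp only [What, betaHat, Nat.sub_self]

theorem What_succ (ψ : Measure ℝ) (m : ℕ) (hm : 1 ≤ m) (x : ℝ) :
    What ψ (m + 1) x =
      (x - betaHat ψ (m + 1) * √(1 - x ^ 2)) * What ψ m x
        - alphaHat ψ (m + 1) * What ψ (m - 1) x := by
  obtain ⟨k, rfl⟩ : ∃ k, m = k + 1 := ⟨m - 1, by omega⟩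
  simp only [betaHat, alphaHat, Nat.add_sub_cancel]
  rw [What]
  rfl

theorem betaHat_succ (ψ : Measure ℝ) (m : ℕ) :
    betaHat ψ (m + 1) = 1 / rhoHat ψ m * ∫ x, x * What ψ m x ^ 2 ∂ψ := rfl

theorem alphaHat_succ (ψ : Measure ℝ) (m : ℕ) (hm : 1 ≤ m) :
    alphaHat ψ (m + 1) = 1 / rhoHat ψ (m - 1) *
      ∫ x, (x - betaHat ψ (m + 1) * √(1 - x ^ 2)) * What ψ (m - 1) x * What ψ m x
        * √(1 - x ^ 2) ∂ψ := by
  obtain ⟨k, rfl⟩ : ∃ k, m = k + 1 := ⟨m - 1, by omega⟩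
  rfl

/-- `g` is a parameter sequence `(g_n)_{n ≥ 0}` of the sequence `(a_n)_{n ≥ 1}`; the value `a 0` is
not used. -/
def IsParameterSequence (a g : ℕ → ℝ) : Prop :=
  0 ≤ g 0 ∧ g 0 < 1 ∧ (∀ n, 1 ≤ n → 0 < g n ∧ g n < 1) ∧
    ∀ n, 1 ≤ n → a n = (1 - g (n - 1)) * g n

/-- `(a_n)_{n ≥ 1}` is a positive chain sequence. -/
def IsPositiveChainSequence (a : ℕ → ℝ) : Prop := ∃ g, IsParameterSequence a g

/-- The minimal parameter sequence: the parameter sequence with initial value `0`. It is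
termwise below every other parameter sequence, see `IsMinimalParameterSequence.le`. -/
def IsMinimalParameterSequence (a m : ℕ → ℝ) : Prop :=
  IsParameterSequence a m ∧ m 0 = 0

/-- The maximal parameter sequence: the parameter sequence that is termwise above every
parameter sequence. -/
def IsMaximalParameterSequence (a M : ℕ → ℝ) : Prop :=
  IsParameterSequence a M ∧ ∀ g, IsParameterSequence a g → ∀ n, g n ≤ M n

theorem IsMinimalParameterSequence.le {a m g : ℕ → ℝ} (hm : IsMinimalParameterSequence a m)
    (hg : IsParameterSequence a g) (n : ℕ) : m n ≤ g n := by
  induction n with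
  | zero => rw [hm.2]; exact hg.1
  | succ k ih =>
    have h1 := hm.1.2.2.2 (k + 1) (by omega)
    have h2 := hg.2.2.2 (k + 1) (by omega)
    have h3 := (hm.1.2.2.1 (k + 1) (by omega)).1
    have h4 : g k < 1 := by
      rcases Nat.eq_zero_or_pos k with rfl | h
      · exact hg.2.1
      · exact (hg.2.2.1 k h).2
    simp only [Nat.add_sub_cancel] at h1 h2
    by_contra! h
    nlinarith [mul_pos (sub_pos.2 h4) (sub_pos.2 h)]

end

/-!
Write `s = √(1 - x²)` and `t = x / s`. Almost everywhere `Ŵ_m(x) = s^m p_m(t)`, where the real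
polynomials `p_m` (`whatPoly`) satisfy the `R_II` recurrence
`p_{m+1} = (t - β_{m+1}) p_m - α_{m+1} (1 + t²) p_{m-1}`. Let `J_m(q) = ∫ s^{2m-1} q(t) dψ`
for `q` of degree at most `2m`; this is finite because `∫ s⁻¹ dψ` is, positive on squares because
the support of `ψ` is infinite, and `J_{m+1}((1 + t²) q) = J_m(q)`. The formulas for the
coefficients then say that `p_m` is orthogonal under `J_m` to all polynomials of degree less than
`m` (`IsRIISystem.orthogonal`).

Two consequences of orthogonality carry the proof. First, reducing modulo `1 + t²` gives
`α_{m+1} = γ_m / γ_{m-1} > 0` with `γ_m = ρ_m (1 + β_{m+1}²)` (`IsRIISystem.a_mul_gamma`).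
Second, `J_m(p_m q) = c_m · [t^m] q` for `q` of degree at most `m`, where `c_m = J_m(p_m t^m)`
(`IsRIISystem.J_p_mul`). Both `c_m` and the leading coefficient `L_m` of `p_m` solve
`y_{m+1} = y_m - α_{m+1} y_{m-1}`, their Wronskian is `γ_m`, and `c_m L_m = J_m(p_m²) > 0`. An
extremal property of `p_m` gives `L_m > 0` (`IsRIISystem.coeff_pos`), hence `c_m > 0`. Therefore
`g_m = 1 - c_{m+1} / c_m` is a parameter sequence, and since `c_0 - c_1 = γ_0 > 0` its initial value
is positive. The maximal parameter sequence, the termwise supremum of all parameter sequences,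
then differs from the minimal one already at the index `0`.

The polynomials on the unit circle are defined by their recurrence, and the relation with `Ŵ_m`
follows by induction from
`(1 + iβ) e^{iθ} + (1 - iβ) = 2 e^{iθ/2} (cos (θ/2) - β sin (θ/2))`.
-/

/-! ### Parameter sequences of chain sequences -/

open Filter in
/-- If a sequence has a parameter sequence then the termwise supremum of all of its
parameter sequences is again one. -/
theorem exists_isMaximalParameterSequence {a g : ℕ → ℝ} (hg : IsParameterSequence a g) :
    ∃ M, IsMaximalParameterSequence a M := by
  have hlt : ∀ h, IsParameterSequence a h → ∀ n, h n < 1 := fun h hh n ↦ by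
    rcases Nat.eq_zero_or_pos n with rfl | hn
    exacts [hh.2.1, (hh.2.2.1 n hn).2]
  have hapos : ∀ n, 0 < a (n + 1) := fun n ↦ by
    have h1 := hg.2.2.2 (n + 1) (by omega)
    rw [Nat.add_sub_cancel] at h1
    rw [h1]
    exact mul_pos (sub_pos.2 (hlt g hg n)) (hg.2.2.1 (n + 1) (by omega)).1
  let P : Type := {h : ℕ → ℝ // IsParameterSequence a h}
  have : Nonempty P := ⟨⟨g, hg⟩⟩
  have hbdd : ∀ n, BddAbove (range fun h : P ↦ h.1 n) := fun n ↦
    ⟨1, by rintro _ ⟨h, rfl⟩; exact (hlt h.1 h.2 n).le⟩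
  set M : ℕ → ℝ := fun n ↦ ⨆ h : P, h.1 n with hM
  have hle : ∀ h, IsParameterSequence a h → ∀ n, h n ≤ M n := fun h hh n ↦
    le_ciSup (hbdd n) ⟨h, hh⟩
  have hMle : ∀ n, M n ≤ 1 := fun n ↦ ciSup_le fun h ↦ (hlt h.1 h.2 n).le
  have hMpos : ∀ n, 0 < M (n + 1) := fun n ↦
    (hg.2.2.1 (n + 1) (by omega)).1.trans_le (hle g hg _)
  have hrec : ∀ h, IsParameterSequence a h → ∀ n, a (n + 1) = (1 - h n) * h (n + 1) :=
    fun h hh n ↦ hh.2.2.2 (n + 1) (by omega)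
  have hup : ∀ n, M n ≤ 1 - a (n + 1) / M (n + 1) := fun n ↦ ciSup_le fun h ↦ by
    have h1 := hrec h.1 h.2 n
    have h2 := hle h.1 h.2 (n + 1)
    have h3 := hlt h.1 h.2 n
    rw [le_sub_comm, div_le_iff₀ (hMpos n)]
    rw [h1]
    exact mul_le_mul_of_nonneg_left h2 (by linarith)
  have hMlt : ∀ n, M n < 1 := fun n ↦ by
    have := div_pos (hapos n) (hMpos n)
    linarith [hup n]
  refine ⟨M, ⟨hg.1.trans (hle g hg 0), hMlt 0, fun n hn ↦ ?_, fun n hn ↦ ?_⟩, hle⟩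
  · obtain ⟨k, rfl⟩ : ∃ k, n = k + 1 := ⟨n - 1, by omega⟩
    exact ⟨hMpos k, hMlt _⟩
  · obtain ⟨k, rfl⟩ : ∃ k, n = k + 1 := ⟨n - 1, by omega⟩
    rw [Nat.add_sub_cancel]
    apply le_antisymm
    · rw [← div_le_iff₀ (hMpos k)]
      linarith [hup k]
    · have h0 : 0 < 1 - M k := sub_pos.2 (hMlt k)
      rw [mul_comm, ← le_div_iff₀ h0]
      refine ciSup_le fun h ↦ ?_
      rw [le_div_iff₀ h0, mul_comm, hrec h.1 h.2 k]
      refine mul_le_mul_of_nonneg_right ?_ (h.2.2.2.1 (k + 1) (by omega)).1.le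
      linarith [hle h.1 h.2 k]

/-- The minimal parameter sequence is obtained by solving the defining equation from the
initial value `0`; comparison with the given parameter sequence keeps it in `(0, 1)`. -/
theorem exists_isMinimalParameterSequence {a g : ℕ → ℝ} (hg : IsParameterSequence a g) :
    ∃ m, IsMinimalParameterSequence a m := by
  let m : ℕ → ℝ := fun n ↦ Nat.rec 0 (fun k y ↦ a (k + 1) / (1 - y)) n
  have hm : ∀ n, m (n + 1) = a (n + 1) / (1 - m n) := fun n ↦ rfl
  have hlt : ∀ n, g n < 1 := fun n ↦ by
    rcases Nat.eq_zero_or_pos n with rfl | hn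
    exacts [hg.2.1, (hg.2.2.1 n hn).2]
  have hrec : ∀ n, a (n + 1) = (1 - g n) * g (n + 1) := fun n ↦ hg.2.2.2 (n + 1) (by omega)
  have hgpos : ∀ n, 0 < g (n + 1) := fun n ↦ (hg.2.2.1 (n + 1) (by omega)).1
  have hle : ∀ n, m n ≤ g n := by
    intro n
    induction n with
    | zero => exact hg.1
    | succ k ih =>
      have := hlt k
      rw [hm, hrec, div_le_iff₀ (by linarith), mul_comm]
      exact mul_le_mul_of_nonneg_left (by linarith) (hgpos k).le
  have hpos : ∀ n, 0 < m (n + 1) := fun n ↦ by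
    rw [hm, hrec]
    have := hlt n
    exact div_pos (mul_pos (by linarith) (hgpos n)) (by linarith [hle n])
  refine ⟨m, ⟨le_rfl, zero_lt_one, fun n hn ↦ ?_, fun n hn ↦ ?_⟩, rfl⟩
  · obtain ⟨k, rfl⟩ : ∃ k, n = k + 1 := ⟨n - 1, by omega⟩
    exact ⟨hpos k, (hle (k + 1)).trans_lt (hlt (k + 1))⟩
  · obtain ⟨k, rfl⟩ : ∃ k, n = k + 1 := ⟨n - 1, by omega⟩
    have : 1 - m k ≠ 0 := by linarith [hle k, hlt k]
    rw [Nat.add_sub_cancel, hm]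
    field_simp

/-- A strictly positive solution `c` of `c_{m+1} = c_m - a_m c_{m-1}` produces the parameter
sequence `1 - c_{m+1} / c_m`. -/
theorem isParameterSequence_of_recurrence {a c : ℕ → ℝ} (hc : ∀ n, 0 < c n) (h01 : c 1 < c 0)
    (ha : ∀ n, 0 < a (n + 1)) (hrec : ∀ n, c (n + 2) = c (n + 1) - a (n + 1) * c n) :
    IsParameterSequence a fun n ↦ 1 - c (n + 1) / c n := by
  refine ⟨?_, ?_, fun n hn ↦ ?_, fun n hn ↦ ?_⟩
  · rw [sub_nonneg, div_le_one (hc 0)]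
    exact h01.le
  · linarith [div_pos (hc 1) (hc 0)]
  · obtain ⟨k, rfl⟩ : ∃ k, n = k + 1 := ⟨n - 1, by omega⟩
    refine ⟨?_, by linarith [div_pos (hc (k + 2)) (hc (k + 1))]⟩
    rw [sub_pos, div_lt_one (hc _), hrec]
    linarith [mul_pos (ha k) (hc k)]
  · obtain ⟨k, rfl⟩ : ∃ k, n = k + 1 := ⟨n - 1, by omega⟩
    have h1 := (hc k).ne'
    have h2 := (hc (k + 1)).ne'
    simp only [Nat.add_sub_cancel]
    rw [show k + 1 + 1 = k + 2 from rfl, hrec]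
    field_simp
    ring

/-! ### The polynomials on the unit circle -/

open Polynomial in
/-- The polynomials `K̂_m`, defined by their recurrence. -/
noncomputable def circlePoly (ψ : Measure ℝ) : ℕ → ℂ[X]
  | 0 => 1
  | 1 => C (1 + Complex.I * betaHat ψ 1) * X + C (1 - Complex.I * betaHat ψ 1)
  | m + 2 => (C (1 + Complex.I * betaHat ψ (m + 2)) * X + C (1 - Complex.I * betaHat ψ (m + 2)))
        * circlePoly ψ (m + 1)
      - C (4 * (alphaHat ψ (m + 2) : ℂ)) * X * circlePoly ψ m

/-- The factor `(1+iβ) z + (1-iβ)` at `z = e^{iθ}` is `2 e^{iθ/2} (cos (θ/2) - β sin (θ/2))`. -/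
theorem linear_factor_eq (b θ : ℝ) :
    (1 + Complex.I * b) * Complex.exp (Complex.I * θ) + (1 - Complex.I * b) =
      Complex.exp (Complex.I * θ / 2) * (2 * (Real.cos (θ / 2) - b * Real.sin (θ / 2) : ℝ)) := by
  have h1 : Complex.exp (Complex.I * θ) = Complex.exp (Complex.I * θ / 2) ^ 2 := by
    rw [← Complex.exp_nat_mul]; congr 1; push_cast; ring
  have h2 : Complex.exp (Complex.I * θ / 2) * Complex.exp (-(Complex.I * θ / 2)) = 1 := by
    rw [← Complex.exp_add]; simp
  have h3 : Complex.I * θ / 2 = ((θ : ℂ) / 2) * Complex.I := by ring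
  have h4 : -(Complex.I * θ / 2) = -((θ : ℂ) / 2) * Complex.I := by ring
  push_cast
  rw [Complex.cos, Complex.sin, ← h3, ← h4, h1]
  linear_combination (Complex.I * b - 1) * h2

theorem circlePoly_eval (ψ : Measure ℝ) {θ : ℝ} (hθ : θ ∈ Icc (0 : ℝ) (2 * Real.pi)) (m : ℕ) :
    Complex.exp (-(Complex.I * m * θ / 2)) * (circlePoly ψ m).eval (Complex.exp (Complex.I * θ)) =
      2 ^ m * (What ψ m (Real.cos (θ / 2)) : ℂ) := by
  have hs : √(1 - Real.cos (θ / 2) ^ 2) = Real.sin (θ / 2) := by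
    rw [← Real.sin_sq, Real.sqrt_sq]
    exact Real.sin_nonneg_of_nonneg_of_le_pi (by linarith [hθ.1]) (by linarith [hθ.2])
  have hE : ∀ k : ℕ, Complex.exp (-(Complex.I * (k + 1 : ℕ) * θ / 2)) *
      Complex.exp (Complex.I * θ / 2) = Complex.exp (-(Complex.I * k * θ / 2)) := fun k ↦ by
    rw [← Complex.exp_add]; congr 1; push_cast; ring
  have hz : Complex.exp (Complex.I * θ) = Complex.exp (Complex.I * θ / 2) ^ 2 := by
    rw [← Complex.exp_nat_mul]; congr 1; push_cast; ring
  induction m using Nat.strong_induction_on with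
  | _ m ih =>
    match m, ih with
    | 0, _ => simp [circlePoly, What_zero]
    | 1, _ =>
      have h1 := linear_factor_eq (betaHat ψ 1) θ
      have h2 := hE 0
      simp only [Nat.cast_zero, mul_zero, zero_mul, zero_div, neg_zero, Complex.exp_zero,
        zero_add] at h2
      simp only [circlePoly, Polynomial.eval_add, Polynomial.eval_mul, Polynomial.eval_C,
        Polynomial.eval_X]
      rw [h1, ← mul_assoc, h2, What_one, hs]
      push_cast
      ring
    | k + 2, ih =>
      have h0 := ih k (by omega)
      have h1 := ih (k + 1) (by omega)
      have hl := linear_factor_eq (betaHat ψ (k + 2)) θ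
      have e1 := hE (k + 1)
      have e0 := hE k
      have hW := What_succ ψ (k + 1) (by omega) (Real.cos (θ / 2))
      rw [hs, Nat.add_sub_cancel, show k + 1 + 1 = k + 2 from rfl] at hW
      rw [show k + 1 + 1 = k + 2 from rfl] at e1
      simp only [circlePoly, Polynomial.eval_sub, Polynomial.eval_add, Polynomial.eval_mul,
        Polynomial.eval_C, Polynomial.eval_X]
      rw [hl, hW]
      rw [← e1] at h1
      rw [← e0, ← e1] at h0
      rw [hz] at h0 h1 ⊢
      push_cast at h0 h1 ⊢
      linear_combination 2 * ((Complex.cos (θ / 2)) - betaHat ψ (k + 2) * Complex.sin (θ / 2)) * h1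
        - 4 * (alphaHat ψ (k + 2) : ℂ) * h0

/-! ### Orthogonality with respect to varying weights -/

open Polynomial

/-- The `R_II` recurrence with coefficients `a`, `b`; the values `a 0`, `a 1` and `b 0` are not
used. -/
structure IsRIIRecurrence (p : ℕ → ℝ[X]) (a b : ℕ → ℝ) : Prop where
  p_zero : p 0 = 1
  p_one : p 1 = X - C (b 1)
  p_add_two : ∀ m, p (m + 2) = (X - C (b (m + 2))) * p (m + 1) - C (a (m + 2)) * (X ^ 2 + 1) * p m

/-- Polynomials `p m` generated by an `R_II` recurrence whose coefficients are determined by a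
family of functionals `J m`. On polynomials of degree at most `2 * m` the functional `J m` plays
the role of integration against `(1 + t²)⁻ᵐ dν(t)` for a positive measure `ν` of infinite
support. -/
structure IsRIISystem (J : ℕ → ℝ[X] →ₗ[ℝ] ℝ) (p : ℕ → ℝ[X]) (a b : ℕ → ℝ) : Prop
    extends IsRIIRecurrence p a b where
  J_succ : ∀ m q, natDegree q ≤ 2 * m → J (m + 1) ((X ^ 2 + 1) * q) = J m q
  J_pos : ∀ m q, q ≠ 0 → natDegree q ≤ m → 0 < J m (q ^ 2)
  b_succ : ∀ m, b (m + 1) * J (m + 1) (p m ^ 2) = J (m + 1) (X * p m ^ 2)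
  a_add_two : ∀ m, a (m + 2) * J (m + 1) (p m ^ 2) =
    J (m + 2) ((X - C (b (m + 2))) * p m * p (m + 1))

theorem natDegree_le_of_degree_lt_succ {q : ℝ[X]} {n : ℕ} (h : q.degree < (n + 1 : ℕ)) :
    natDegree q ≤ n :=
  natDegree_le_iff_coeff_eq_zero.2 fun k hk ↦ (degree_lt_iff_coeff_zero _ _).1 h k hk

theorem degree_lt_succ_of_natDegree_le {q : ℝ[X]} {n : ℕ} (h : natDegree q ≤ n) :
    q.degree < (n + 1 : ℕ) :=
  (degree_le_of_natDegree_le h).trans_lt (by exact_mod_cast Nat.lt_succ_self n)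

/-- A real polynomial vanishing at `i` is divisible by `X² + 1`. -/
theorem exists_eq_X_sq_add_one_mul {q : ℝ[X]} {n : ℕ} (hq : q.degree < (n + 2 : ℕ))
    (h : aeval Complex.I q = 0) : ∃ r : ℝ[X], r.degree < n ∧ q = (X ^ 2 + 1) * r := by
  have hdeg : (X ^ 2 + 1 : ℝ[X]).degree = (2 : ℕ) := by
    rw [← C_1]; exact degree_X_pow_add_C (by norm_num) _
  have hmonic : (X ^ 2 + 1 : ℝ[X]).Monic := by
    rw [← C_1]; exact monic_X_pow_add_C _ (by norm_num)
  have hdvd : (X ^ 2 + 1 : ℝ[X]) ∣ q := by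
    rw [← modByMonic_eq_zero_iff_dvd hmonic]
    have hlt := degree_modByMonic_lt q hmonic
    set u := q %ₘ (X ^ 2 + 1) with hu
    have hev : aeval Complex.I u = 0 := by
      have h1 := modByMonic_add_div q (X ^ 2 + 1 : ℝ[X])
      rw [← hu] at h1
      have h2 := congrArg (aeval Complex.I) h1
      simpa [h] using h2
    rw [hdeg] at hlt
    have hform := eq_X_add_C_of_natDegree_le_one (natDegree_le_of_degree_lt_succ hlt)
    rw [hform] at hev
    simp only [map_add, map_mul, aeval_C, aeval_X, Complex.coe_algebraMap] at hev
    have hre := congrArg Complex.re hev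
    have him := congrArg Complex.im hev
    simp at hre him
    rw [hform, hre, him]
    simp
  obtain ⟨r, rfl⟩ := hdvd
  refine ⟨r, ?_, rfl⟩
  rcases eq_or_ne r 0 with rfl | hr
  · rw [degree_zero]; exact WithBot.bot_lt_coe n
  · rw [degree_mul, hdeg, degree_eq_natDegree hr] at hq
    rw [degree_eq_natDegree hr]
    norm_cast at hq ⊢
    omega

namespace IsRIIRecurrence

variable {p : ℕ → ℝ[X]} {a b : ℕ → ℝ}

theorem natDegree_le (S : IsRIIRecurrence p a b) (m : ℕ) : natDegree (p m) ≤ m := by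
  have key : ∀ m, natDegree (p m) ≤ m ∧ natDegree (p (m + 1)) ≤ m + 1 := by
    intro m
    induction m with
    | zero => exact ⟨by simp [S.p_zero], by rw [S.p_one]; compute_degree⟩
    | succ k ih =>
      refine ⟨ih.2, ?_⟩
      have h1 := ih.1
      have h2 := ih.2
      rw [S.p_add_two]
      have e1 : natDegree (X - C (b (k + 2))) ≤ 1 := by compute_degree
      have e2 : natDegree (C (a (k + 2)) * (X ^ 2 + 1)) ≤ 2 := by compute_degree
      refine (natDegree_sub_le_of_le (natDegree_mul_le_of_le e1 h2)
        (natDegree_mul_le_of_le e2 h1)).trans ?_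
      rw [max_le_iff]
      omega
  exact (key m).1

theorem degree_lt (S : IsRIIRecurrence p a b) (m : ℕ) : degree (p m) < (m + 1 : ℕ) :=
  degree_lt_succ_of_natDegree_le (S.natDegree_le m)

/-- The recurrence, uniformly in `m`: the last term is a multiple of `X² + 1`. -/
theorem exists_p_succ_eq (S : IsRIIRecurrence p a b) (m : ℕ) :
    ∃ u : ℝ[X], u.degree < m ∧ p (m + 1) = (X - C (b (m + 1))) * p m - (X ^ 2 + 1) * u := by
  cases m with
  | zero => exact ⟨0, by simp, by simp [S.p_zero, S.p_one]⟩
  | succ k =>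
    refine ⟨C (a (k + 2)) * p k, ?_, by rw [S.p_add_two]; ring⟩
    refine lt_of_le_of_lt ?_ (S.degree_lt k)
    exact (degree_mul_le _ _).trans (by simpa using add_le_add_left degree_C_le (degree (p k)))

theorem aeval_I_succ (S : IsRIIRecurrence p a b) (m : ℕ) :
    aeval Complex.I (p (m + 1)) = (Complex.I - b (m + 1)) * aeval Complex.I (p m) := by
  obtain ⟨u, -, h⟩ := S.exists_p_succ_eq m
  rw [h]
  simp

theorem aeval_I_ne_zero (S : IsRIIRecurrence p a b) (m : ℕ) : aeval Complex.I (p m) ≠ 0 := by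
  induction m with
  | zero => simp [S.p_zero]
  | succ k ih =>
    rw [S.aeval_I_succ]
    refine mul_ne_zero (fun h ↦ ?_) ih
    simpa using congrArg Complex.im h

theorem ne_zero (S : IsRIIRecurrence p a b) (m : ℕ) : p m ≠ 0 := fun h ↦
  S.aeval_I_ne_zero m (by rw [h, map_zero])

end IsRIIRecurrence

namespace IsRIISystem

variable {J : ℕ → ℝ[X] →ₗ[ℝ] ℝ} {p : ℕ → ℝ[X]} {a b : ℕ → ℝ}

theorem rho_pos (S : IsRIISystem J p a b) (m : ℕ) : 0 < J (m + 1) (p m ^ 2) :=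
  S.J_pos _ _ (S.ne_zero m) ((S.natDegree_le m).trans (Nat.le_succ m))

/-- Modulo `X² + 1`, every polynomial is a combination of two consecutive `p m`. -/
theorem exists_decomp (S : IsRIISystem J p a b) (m : ℕ) {q : ℝ[X]} (hq : q.degree < (m + 2 : ℕ)) :
    ∃ (r : ℝ[X]) (x y : ℝ), r.degree < m ∧
      q = (X ^ 2 + 1) * r + C x * p (m + 1) + C y * p m := by
  set P := aeval Complex.I (p m) with hP
  have hP0 : P ≠ 0 := S.aeval_I_ne_zero m
  set w := aeval Complex.I q / P with hw
  set x : ℝ := w.im with hx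
  set y : ℝ := w.re + w.im * b (m + 1) with hy
  have hwxy : w = x * (Complex.I - b (m + 1)) + y := by
    apply Complex.ext <;> simp [hx, hy]
  have hdeg : ∀ (z : ℝ) (s : ℝ[X]), s.degree < (m + 2 : ℕ) → (C z * s).degree < (m + 2 : ℕ) :=
    fun z s hs ↦ lt_of_le_of_lt
      ((degree_mul_le _ _).trans (by simpa using add_le_add_left degree_C_le (degree s))) hs
  obtain ⟨r, hr, h⟩ := exists_eq_X_sq_add_one_mul (n := m) (q := q - C x * p (m + 1) - C y * p m)
    (by
      refine (degree_sub_le _ _).trans_lt (max_lt ((degree_sub_le _ _).trans_lt (max_lt hq ?_)) ?_)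
      · exact hdeg _ _ (S.degree_lt (m + 1))
      · exact hdeg _ _ ((S.degree_lt m).trans (by exact_mod_cast Nat.lt_succ_self _)))
    (by
      have : aeval Complex.I q = w * P := by rw [hw]; field_simp
      simp only [map_sub, map_mul, aeval_C, S.aeval_I_succ, this, hwxy, Complex.coe_algebraMap]
      ring)
  exact ⟨r, x, y, hr, by rw [← h]; ring⟩

/-- `J m` of a product, in the form needed to lower the index. -/
theorem J_succ_mul (S : IsRIISystem J p a b) {m : ℕ} {f g : ℝ[X]} {k l : ℕ} (hf : natDegree f ≤ k)
    (hg : natDegree g ≤ l) (h : k + l ≤ 2 * m) :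
    J (m + 1) ((X ^ 2 + 1) * (f * g)) = J m (f * g) :=
  S.J_succ m _ ((natDegree_mul_le_of_le hf hg).trans h)

/-- Orthogonality: `p m` is orthogonal, with respect to `J m`, to all polynomials of smaller
degree. The inductive step uses the decomposition of a polynomial of degree at most `m` into a
multiple of `X² + 1`, on which the recurrence reduces to smaller indices, and multiples of
`p m` and `p (m - 1)`, for which orthogonality is the definition of the coefficients. -/
theorem orthogonal (S : IsRIISystem J p a b) (m : ℕ) (q : ℝ[X]) (hq : q.degree < m) :
    J m (p m * q) = 0 := by
  induction m using Nat.strong_induction_on generalizing q with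
  | _ m ih =>
    match m, ih with
    | 0, _ =>
      have : q = 0 := by
        rw [← degree_eq_bot]
        simpa using hq
      simp [this]
    | 1, _ =>
      have hle : natDegree q ≤ 0 := natDegree_le_of_degree_lt_succ hq
      have hb := S.b_succ 0
      rw [eq_C_of_natDegree_le_zero hle, S.p_one, mul_comm, ← smul_eq_C_mul, map_smul, map_sub]
      rw [S.p_zero, one_pow, mul_one] at hb
      rw [← mul_one (C (b 1)), ← smul_eq_C_mul, map_smul, smul_eq_mul (b 1), hb, sub_self,
        smul_zero]
    | m + 2, ih =>
      obtain ⟨r, x, y, hr, rfl⟩ := S.exists_decomp m hq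
      have hr' : natDegree r ≤ m := natDegree_le_of_degree_le hr.le
      have hpm := S.natDegree_le m
      have hp1 := S.natDegree_le (m + 1)
      have hp2 := S.natDegree_le (m + 2)
      -- the part divisible by `X² + 1`
      have h1 : J (m + 2) (p (m + 2) * ((X ^ 2 + 1) * r)) = 0 := by
        rcases Nat.eq_zero_or_pos m with rfl | hm
        · have : r = 0 := by
            rw [← degree_eq_bot]
            simpa using hr
          simp [this]
        have hrr : natDegree r ≤ m - 1 := by
          rcases eq_or_ne r 0 with rfl | h0
          · simp
          · have := (natDegree_lt_iff_degree_lt h0).2 hr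
            omega
        have e1 : J (m + 2) (p (m + 2) * ((X ^ 2 + 1) * r)) = J (m + 1) (p (m + 2) * r) := by
          rw [mul_left_comm]
          exact S.J_succ_mul hp2 hrr (by omega)
        have e2 : J (m + 1) ((X ^ 2 + 1) * (p m * r)) = J m (p m * r) :=
          S.J_succ_mul hpm hrr (by omega)
        have e3 : p (m + 2) * r = p (m + 1) * ((X - C (b (m + 2))) * r)
            - a (m + 2) • ((X ^ 2 + 1) * (p m * r)) := by
          rw [S.p_add_two, smul_eq_C_mul]; ring
        rw [e1, e3, map_sub, map_smul, e2, ih m (by omega) r hr, ih (m + 1) (by omega), smul_zero,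
          sub_zero]
        have hd : natDegree ((X - C (b (m + 2))) * r) ≤ m := by
          refine (natDegree_mul_le_of_le (m := 1) (by compute_degree) hrr).trans ?_
          omega
        exact degree_lt_succ_of_natDegree_le hd
      have e : J (m + 2) ((X ^ 2 + 1) * (p m * p (m + 1))) = J (m + 1) (p m * p (m + 1)) :=
        S.J_succ_mul hpm hp1 (by omega)
      have e0 : J (m + 1) (p m * p (m + 1)) = 0 := by
        rw [mul_comm]
        exact ih (m + 1) (by omega) _ (S.degree_lt m)
      -- the part along `p (m + 1)`
      have h2 : J (m + 2) (p (m + 2) * p (m + 1)) = 0 := by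
        have : p (m + 2) * p (m + 1) = X * p (m + 1) ^ 2 - b (m + 2) • p (m + 1) ^ 2
            - a (m + 2) • ((X ^ 2 + 1) * (p m * p (m + 1))) := by
          rw [S.p_add_two, smul_eq_C_mul, smul_eq_C_mul]; ring
        rw [this, map_sub, map_sub, map_smul, map_smul, e, e0, smul_eq_mul, S.b_succ]
        simp
      -- the part along `p m`
      have h3 : J (m + 2) (p (m + 2) * p m) = 0 := by
        have : p (m + 2) * p m = (X - C (b (m + 2))) * p m * p (m + 1)
            - a (m + 2) • ((X ^ 2 + 1) * (p m * p m)) := by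
          rw [S.p_add_two, smul_eq_C_mul]; ring
        rw [this, map_sub, map_smul, S.J_succ_mul hpm hpm (by omega), ← S.a_add_two, ← sq]
        simp
      have : p (m + 2) * ((X ^ 2 + 1) * r + C x * p (m + 1) + C y * p m) =
          p (m + 2) * ((X ^ 2 + 1) * r) + x • (p (m + 2) * p (m + 1))
            + y • (p (m + 2) * p m) := by
        rw [smul_eq_C_mul, smul_eq_C_mul]; ring
      rw [this, map_add, map_add, map_smul, map_smul, h1, h2, h3]
      simp

/-- With `γ m = J (m + 1) (p m ^ 2) * (1 + b (m + 1) ^ 2)` this says that the coefficient `a` is a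
quotient of consecutive `γ`; in particular it is positive. It holds because, modulo `X² + 1`,
`(1 + b²) (X - b') p m` is congruent to `((b' - b) X + (1 + b b')) p (m + 1)`, where
`b = b (m + 1)` and `b' = b (m + 2)`. -/
theorem a_mul_gamma (S : IsRIISystem J p a b) (m : ℕ) :
    a (m + 2) * (J (m + 1) (p m ^ 2) * (1 + b (m + 1) ^ 2)) =
      J (m + 2) (p (m + 1) ^ 2) * (1 + b (m + 2) ^ 2) := by
  obtain ⟨u, hu, h⟩ := S.exists_p_succ_eq m
  set β := b (m + 1)
  set β' := b (m + 2) with hβ'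
  set l : ℝ[X] := C (β' - β) * X + C (1 + β * β') with hl
  set r : ℝ[X] := l * u - C (β' - β) * p m with hr
  have hpm := S.natDegree_le m
  have hrd : r.natDegree ≤ m := by
    rcases eq_or_ne u 0 with rfl | h0
    · rw [hr, mul_zero, zero_sub, natDegree_neg]
      exact (natDegree_C_mul_le _ _).trans hpm
    have hum : u.natDegree < m := (natDegree_lt_iff_degree_lt h0).2 hu
    have hl1 : l.natDegree ≤ 1 := by rw [hl]; compute_degree
    refine (natDegree_sub_le_of_le (natDegree_mul_le_of_le hl1 le_rfl)
      (natDegree_C_mul_le _ _)).trans ?_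
    rw [max_le_iff]
    omega
  have h0 : J (m + 2) ((X ^ 2 + 1) * (p (m + 1) * r)) = 0 := by
    rw [S.J_succ_mul (S.natDegree_le (m + 1)) hrd (by omega)]
    exact S.orthogonal _ _ (degree_lt_succ_of_natDegree_le hrd)
  have hid : (1 + β ^ 2) • ((X - C β') * p m * p (m + 1)) =
      (β' - β) • (X * p (m + 1) ^ 2) + (1 + β * β') • p (m + 1) ^ 2
        + (X ^ 2 + 1) * (p (m + 1) * r) := by
    simp only [smul_eq_C_mul, hr, hl]
    rw [sq (p (m + 1))]
    nth_rewrite 3 [h]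
    nth_rewrite 4 [h]
    simp only [map_add, map_sub, map_mul, map_pow, map_one]
    ring
  have h1 := congrArg (J (m + 2)) hid
  simp only [map_add, map_smul, smul_eq_mul, h0, ← S.b_succ] at h1
  rw [hβ', ← S.a_add_two, ← hβ'] at h1
  linear_combination h1

theorem gamma_pos (S : IsRIISystem J p a b) (m : ℕ) :
    0 < J (m + 1) (p m ^ 2) * (1 + b (m + 1) ^ 2) :=
  mul_pos (S.rho_pos m) (by positivity)

theorem a_pos (S : IsRIISystem J p a b) (m : ℕ) : 0 < a (m + 2) := by
  have h := S.gamma_pos (m + 1)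
  rw [← S.a_mul_gamma] at h
  exact (pos_iff_pos_of_mul_pos h).2 (S.gamma_pos m)

/-- By orthogonality `q ↦ J m (p m * q)` is a multiple of the coefficient of `X ^ m`, which is the
value at the point at infinity. -/
theorem J_p_mul (S : IsRIISystem J p a b) {m : ℕ} {q : ℝ[X]} (hq : natDegree q ≤ m) :
    J m (p m * q) = J m (p m * X ^ m) * q.coeff m := by
  have hd : (q - C (q.coeff m) * X ^ m).degree < (m : WithBot ℕ) := by
    rw [degree_lt_iff_coeff_zero]
    intro k hk
    rcases hk.eq_or_lt with rfl | hlt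
    · simp
    · simp [coeff_eq_zero_of_natDegree_lt (hq.trans_lt hlt), hlt.ne']
  have h := S.orthogonal m _ hd
  have : p m * (q - C (q.coeff m) * X ^ m) = p m * q - q.coeff m • (p m * X ^ m) := by
    rw [smul_eq_C_mul]; ring
  rw [this, map_sub, map_smul, smul_eq_mul, sub_eq_zero] at h
  rw [h, mul_comm]

/-- The first step of the recurrence for `c m = J m (p m * X ^ m)`; the drop `c 0 - c 1` is the
positive number that makes the initial parameter positive. -/
theorem c_one (S : IsRIISystem J p a b) :
    J 1 (p 1 * X ^ 1) = J 0 (p 0 * X ^ 0) - J 1 (p 0 ^ 2) * (1 + b 1 ^ 2) := by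
  have h1 := S.J_succ 0 1 (by simp)
  have hb := S.b_succ 0
  have e : p 1 * X ^ 1 = (X ^ 2 + 1) * 1 - 1 - b 1 • X := by
    rw [S.p_one, smul_eq_C_mul]; ring
  rw [S.p_zero, one_pow, mul_one, zero_add] at hb
  rw [zero_add] at h1
  rw [e, map_sub, map_sub, h1, map_smul, smul_eq_mul, ← hb, S.p_zero, one_pow, pow_zero, mul_one]
  ring

/-- The numbers `c m = J m (p m * X ^ m)` satisfy the same recurrence as the coefficients of
`X ^ m` in `p m`. It comes from pairing `p (m + 2)` with `(X² + 1) X ^ m`, whose index can be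
lowered. -/
theorem c_add_two (S : IsRIISystem J p a b) (m : ℕ) :
    J (m + 2) (p (m + 2) * X ^ (m + 2)) =
      J (m + 1) (p (m + 1) * X ^ (m + 1)) - a (m + 2) * J m (p m * X ^ m) := by
  have hX : natDegree (X ^ m : ℝ[X]) ≤ m := natDegree_X_pow_le m
  have h1 : J (m + 2) (p (m + 2) * ((X ^ 2 + 1) * X ^ m)) =
      J (m + 2) (p (m + 2) * X ^ (m + 2)) := by
    rw [S.J_p_mul ((natDegree_mul_le_of_le (m := 2) (by compute_degree) hX).trans (by omega))]
    have : ((X ^ 2 + 1) * X ^ m : ℝ[X]).coeff (m + 2) = 1 := by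
      rw [add_mul, one_mul, ← pow_add, coeff_add, coeff_X_pow, coeff_X_pow]
      rw [if_pos (by omega), if_neg (by omega), add_zero]
    rw [this, mul_one]
  have h2 : J (m + 1) (p (m + 1) * ((X - C (b (m + 2))) * X ^ m)) =
      J (m + 1) (p (m + 1) * X ^ (m + 1)) := by
    rw [S.J_p_mul ((natDegree_mul_le_of_le (m := 1) (by compute_degree) hX).trans (by omega))]
    have : ((X - C (b (m + 2))) * X ^ m : ℝ[X]).coeff (m + 1) = 1 := by
      rw [sub_mul, ← pow_succ', coeff_sub, coeff_X_pow, coeff_C_mul, coeff_X_pow]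
      rw [if_pos rfl, if_neg (by omega), mul_zero, sub_zero]
    rw [this, mul_one]
  rw [← h1, ← h2, mul_left_comm, S.J_succ_mul (S.natDegree_le (m + 2)) hX (by omega)]
  have : p (m + 2) * X ^ m = p (m + 1) * ((X - C (b (m + 2))) * X ^ m)
      - a (m + 2) • ((X ^ 2 + 1) * (p m * X ^ m)) := by
    rw [S.p_add_two, smul_eq_C_mul]; ring
  rw [this, map_sub, map_smul, smul_eq_mul, S.J_succ_mul (S.natDegree_le m) hX (by omega)]

theorem coeff_add_two (S : IsRIISystem J p a b) (m : ℕ) :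
    (p (m + 2)).coeff (m + 2) = (p (m + 1)).coeff (m + 1) - a (m + 2) * (p m).coeff m := by
  have h1 : (p (m + 1)).coeff (m + 2) = 0 :=
    coeff_eq_zero_of_natDegree_lt ((S.natDegree_le (m + 1)).trans_lt (by omega))
  have h2 : (p m).coeff (m + 2) = 0 :=
    coeff_eq_zero_of_natDegree_lt ((S.natDegree_le m).trans_lt (by omega))
  rw [S.p_add_two, mul_assoc, sub_mul, add_mul, one_mul, coeff_sub, coeff_sub, coeff_X_mul,
    coeff_C_mul, coeff_C_mul, coeff_add, coeff_X_pow_mul, h1, h2]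
  ring

theorem c_mul_coeff_pos (S : IsRIISystem J p a b) (m : ℕ) :
    0 < J m (p m * X ^ m) * (p m).coeff m := by
  rw [← S.J_p_mul (S.natDegree_le m), ← sq]
  exact S.J_pos _ _ (S.ne_zero m) (S.natDegree_le m)

/-- The Wronskian of the two solutions `J m (p m * X ^ m)` and `(p m).coeff m` of
`y (m + 2) = y (m + 1) - a (m + 2) * y m`. -/
theorem wronskian (S : IsRIISystem J p a b) (m : ℕ) :
    J m (p m * X ^ m) * (p (m + 1)).coeff (m + 1)
      - J (m + 1) (p (m + 1) * X ^ (m + 1)) * (p m).coeff m =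
        J (m + 1) (p m ^ 2) * (1 + b (m + 1) ^ 2) := by
  induction m with
  | zero =>
    have h0 : (p 0).coeff 0 = 1 := by simp [S.p_zero]
    have h1 : (p 1).coeff 1 = 1 := by simp [S.p_one]
    simp only [zero_add]
    rw [h0, h1, S.c_one]
    ring
  | succ k ih =>
    rw [S.c_add_two, S.coeff_add_two, ← S.a_mul_gamma, ← ih]
    ring

/-- Positivity of the coefficient `L m` of `X ^ m` in `p m`. The ratio `J m (p m ^ 2) / L m ^ 2` is
the minimum of `J m (q ^ 2)` over the `q` of degree `m` with leading coefficient `1`; comparing with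
`q = X * p m / L m` shows that the ratio decreases, and the Wronskian turns this into
`0 < L m * L (m + 1)`. -/
theorem coeff_pos (S : IsRIISystem J p a b) (m : ℕ) : 0 < (p m).coeff m := by
  induction m with
  | zero => simp [S.p_zero]
  | succ m ih =>
    have hpm := S.natDegree_le m
    have hp1 := S.natDegree_le (m + 1)
    have hw := S.wronskian m
    have hγ := S.gamma_pos m
    have hρ := S.rho_pos m
    have hτ := S.c_mul_coeff_pos (m + 1)
    have hXp : natDegree (X * p m) ≤ m + 1 :=
      (natDegree_mul_le_of_le natDegree_X_le hpm).trans (by omega)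
    have e1 : J (m + 1) (p (m + 1) * p (m + 1)) = _ := S.J_p_mul hp1
    have e2 : J (m + 1) (p (m + 1) * (X * p m)) = _ := S.J_p_mul hXp
    have e3 : J (m + 1) (X ^ 2 * p m ^ 2) =
        J m (p m * X ^ m) * (p m).coeff m - J (m + 1) (p m ^ 2) := by
      rw [← S.J_p_mul hpm, ← S.J_succ_mul hpm hpm (by omega), ← map_sub]
      congr 1
      ring
    rw [coeff_X_mul] at e2
    set L := (p m).coeff m
    set L' := (p (m + 1)).coeff (m + 1)
    have hsq : 0 ≤ J (m + 1) ((L • p (m + 1) - L' • (X * p m)) ^ 2) := by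
      rcases eq_or_ne (L • p (m + 1) - L' • (X * p m)) 0 with h | h
      · simp [h]
      · exact (S.J_pos _ _ h ((natDegree_sub_le_of_le ((natDegree_smul_le _ _).trans hp1)
          ((natDegree_smul_le _ _).trans hXp)).trans (max_self _).le)).le
    have hexp : (L • p (m + 1) - L' • (X * p m)) ^ 2 =
        L ^ 2 • (p (m + 1) * p (m + 1)) - (2 * L * L') • (p (m + 1) * (X * p m))
          + L' ^ 2 • (X ^ 2 * p m ^ 2) := by
      simp only [smul_eq_C_mul, map_mul, map_pow]
      rw [show (C (2 : ℝ) : ℝ[X]) = 2 from rfl]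
      ring
    rw [hexp] at hsq
    simp only [map_add, map_sub, map_smul, smul_eq_mul, e1, e2, e3] at hsq
    have hL' : L' ≠ 0 := right_ne_zero_of_mul hτ.ne'
    have hpos : 0 < J (m + 1) (p m ^ 2) * L' ^ 2 := by positivity
    have hfin : 0 < (L * (J (m + 1) (p m ^ 2) * (1 + b (m + 1) ^ 2))) * L' := by
      rw [← hw]
      linarith
    exact (pos_iff_pos_of_mul_pos hfin).1 (mul_pos ih hγ)

theorem c_pos (S : IsRIISystem J p a b) (m : ℕ) : 0 < J m (p m * X ^ m) :=
  (pos_iff_pos_of_mul_pos (S.c_mul_coeff_pos m)).2 (S.coeff_pos m)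

/-- The coefficients have a parameter sequence with positive initial value. -/
theorem exists_isParameterSequence (S : IsRIISystem J p a b) :
    ∃ g, IsParameterSequence (fun n ↦ a (n + 1)) g ∧ 0 < g 0 := by
  have h01 : J 1 (p 1 * X ^ 1) < J 0 (p 0 * X ^ 0) := by
    have := S.gamma_pos 0
    have := S.c_one
    simp only [zero_add] at *
    linarith
  refine ⟨_, isParameterSequence_of_recurrence (c := fun m ↦ J m (p m * X ^ m)) S.c_pos h01
    S.a_pos S.c_add_two, ?_⟩
  have := S.c_pos 0
  simp only [zero_add]
  rw [sub_pos, div_lt_one this]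
  exact h01

end IsRIISystem

/-! ### The functionals defined by the measure -/

/-- Integrability of `(1 - x²)^(-1/2)` forces the measure onto the open interval. -/
theorem ae_one_sub_sq_pos {ψ : Measure ℝ}
    (hint : ∫⁻ x, ENNReal.ofReal (1 - x ^ 2) ^ (-(1 / 2) : ℝ) ∂ψ < ∞) :
    ∀ᵐ x ∂ψ, 0 < 1 - x ^ 2 := by
  have hm : Measurable fun x : ℝ ↦ ENNReal.ofReal (1 - x ^ 2) ^ (-(1 / 2) : ℝ) := by fun_prop
  filter_upwards [ae_lt_top hm hint.ne] with x hx
  by_contra! h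
  rw [ENNReal.ofReal_of_nonpos h, ENNReal.zero_rpow_of_neg (by norm_num)] at hx
  exact lt_irrefl _ hx

theorem integrable_inv_sqrt {ψ : Measure ℝ}
    (hint : ∫⁻ x, ENNReal.ofReal (1 - x ^ 2) ^ (-(1 / 2) : ℝ) ∂ψ < ∞) :
    Integrable (fun x ↦ (√(1 - x ^ 2))⁻¹) ψ := by
  have hm : Measurable fun x : ℝ ↦ (√(1 - x ^ 2))⁻¹ := by fun_prop
  refine ⟨hm.aestronglyMeasurable, ?_⟩
  rw [hasFiniteIntegral_iff_ofReal (Filter.Eventually.of_forall fun x ↦ by positivity)]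
  refine lt_of_le_of_lt (le_of_eq (lintegral_congr_ae ?_)) hint
  filter_upwards [ae_one_sub_sq_pos hint] with x hx
  rw [ENNReal.ofReal_rpow_of_pos hx, Real.rpow_neg hx.le, Real.sqrt_eq_rpow]

/-- The moments of `weightedFunctional ψ m`, used for `k ≤ 2 * m` only. -/
noncomputable def weightedMoment (ψ : Measure ℝ) (m k : ℕ) : ℝ :=
  ∫ x, x ^ k * √(1 - x ^ 2) ^ (2 * m - k) * (√(1 - x ^ 2))⁻¹ ∂ψ

/-- The functional `q ↦ ∫ s^(2m-1) q(x/s) dψ(x)`, `s = √(1 - x²)`, on polynomials of degree at most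
`2m`, defined through its moments and extended by zero to higher powers of the variable, where the
integral may diverge. -/
noncomputable def weightedFunctional (ψ : Measure ℝ) (m : ℕ) : ℝ[X] →ₗ[ℝ] ℝ :=
  ∑ k ∈ Finset.range (2 * m + 1), weightedMoment ψ m k • lcoeff ℝ k

theorem integrable_weightedMoment {ψ : Measure ℝ}
    (hint : ∫⁻ x, ENNReal.ofReal (1 - x ^ 2) ^ (-(1 / 2) : ℝ) ∂ψ < ∞) (m k : ℕ) :
    Integrable (fun x ↦ x ^ k * √(1 - x ^ 2) ^ (2 * m - k) * (√(1 - x ^ 2))⁻¹) ψ := by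
  refine (integrable_inv_sqrt hint).bdd_mul (c := 1) (by fun_prop) ?_
  filter_upwards [ae_one_sub_sq_pos hint] with x hx
  have h1 : |x| ≤ 1 := abs_le_one_iff_mul_self_le_one.2 (by nlinarith)
  have h2 : √(1 - x ^ 2) ≤ 1 := Real.sqrt_le_one.2 (by nlinarith [sq_nonneg x])
  rw [norm_mul, norm_pow, norm_pow, Real.norm_eq_abs, Real.norm_of_nonneg (Real.sqrt_nonneg _)]
  exact mul_le_one₀ (pow_le_one₀ (abs_nonneg _) h1) (by positivity)
    (pow_le_one₀ (Real.sqrt_nonneg _) h2)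

theorem weighted_eval_ae_eq {ψ : Measure ℝ}
    (hint : ∫⁻ x, ENNReal.ofReal (1 - x ^ 2) ^ (-(1 / 2) : ℝ) ∂ψ < ∞)
    (m : ℕ) {q : ℝ[X]} (hq : natDegree q ≤ 2 * m) :
    (fun x ↦ √(1 - x ^ 2) ^ (2 * m) * q.eval (x / √(1 - x ^ 2)) * (√(1 - x ^ 2))⁻¹) =ᵐ[ψ]
      fun x ↦ ∑ k ∈ Finset.range (2 * m + 1),
        q.coeff k * (x ^ k * √(1 - x ^ 2) ^ (2 * m - k) * (√(1 - x ^ 2))⁻¹) := by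
  filter_upwards [ae_one_sub_sq_pos hint] with x hx
  have hs : √(1 - x ^ 2) ≠ 0 := (Real.sqrt_pos.2 hx).ne'
  rw [eval_eq_sum_range' (Nat.lt_succ_of_le hq), Finset.mul_sum, Finset.sum_mul]
  refine Finset.sum_congr rfl fun k hk ↦ ?_
  obtain ⟨j, hj⟩ : ∃ j, 2 * m = k + j :=
    ⟨2 * m - k, by have := Finset.mem_range.1 hk; omega⟩
  rw [hj, Nat.add_sub_cancel_left, pow_add, div_pow]
  field_simp

theorem integrable_weighted_eval {ψ : Measure ℝ}
    (hint : ∫⁻ x, ENNReal.ofReal (1 - x ^ 2) ^ (-(1 / 2) : ℝ) ∂ψ < ∞)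
    (m : ℕ) {q : ℝ[X]} (hq : natDegree q ≤ 2 * m) :
    Integrable
      (fun x ↦ √(1 - x ^ 2) ^ (2 * m) * q.eval (x / √(1 - x ^ 2)) * (√(1 - x ^ 2))⁻¹) ψ :=
  (integrable_congr (weighted_eval_ae_eq hint m hq)).2
    (integrable_finsetSum _ fun k _ ↦ (integrable_weightedMoment hint m k).const_mul _)

theorem weightedFunctional_eq_integral {ψ : Measure ℝ}
    (hint : ∫⁻ x, ENNReal.ofReal (1 - x ^ 2) ^ (-(1 / 2) : ℝ) ∂ψ < ∞)
    (m : ℕ) {q : ℝ[X]} (hq : natDegree q ≤ 2 * m) :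
    weightedFunctional ψ m q =
      ∫ x, √(1 - x ^ 2) ^ (2 * m) * q.eval (x / √(1 - x ^ 2)) * (√(1 - x ^ 2))⁻¹ ∂ψ := by
  rw [integral_congr_ae (weighted_eval_ae_eq hint m hq),
    integral_finsetSum _ fun k _ ↦ (integrable_weightedMoment hint m k).const_mul _]
  simp only [weightedFunctional, LinearMap.sum_apply, LinearMap.smul_apply, lcoeff_apply,
    smul_eq_mul, integral_const_mul, weightedMoment]
  exact Finset.sum_congr rfl fun k _ ↦ mul_comm _ _

theorem weightedFunctional_succ {ψ : Measure ℝ}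
    (hint : ∫⁻ x, ENNReal.ofReal (1 - x ^ 2) ^ (-(1 / 2) : ℝ) ∂ψ < ∞)
    (m : ℕ) {q : ℝ[X]} (hq : natDegree q ≤ 2 * m) :
    weightedFunctional ψ (m + 1) ((X ^ 2 + 1) * q) = weightedFunctional ψ m q := by
  have hq' : natDegree ((X ^ 2 + 1) * q) ≤ 2 * (m + 1) :=
    (natDegree_mul_le_of_le (m := 2) (by compute_degree) hq).trans (by omega)
  rw [weightedFunctional_eq_integral hint _ hq', weightedFunctional_eq_integral hint _ hq]
  refine integral_congr_ae ?_
  filter_upwards [ae_one_sub_sq_pos hint] with x hx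
  have hs : √(1 - x ^ 2) ≠ 0 := (Real.sqrt_pos.2 hx).ne'
  have h2 : √(1 - x ^ 2) ^ 2 * ((x / √(1 - x ^ 2)) ^ 2 + 1) = 1 := by
    rw [div_pow, mul_add, mul_div_cancel₀ _ (pow_ne_zero 2 hs), Real.sq_sqrt hx.le]
    ring
  simp only [eval_mul, eval_add, eval_pow, eval_X, eval_one]
  rw [show 2 * (m + 1) = 2 * m + 2 by ring, pow_add]
  linear_combination √(1 - x ^ 2) ^ (2 * m) * q.eval (x / √(1 - x ^ 2)) * (√(1 - x ^ 2))⁻¹ * h2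

theorem weightedFunctional_sq_pos {ψ : Measure ℝ}
    (hint : ∫⁻ x, ENNReal.ofReal (1 - x ^ 2) ^ (-(1 / 2) : ℝ) ∂ψ < ∞)
    (hsupp : ψ.support.Infinite) (m : ℕ) {q : ℝ[X]} (hq0 : q ≠ 0) (hq : natDegree q ≤ m) :
    0 < weightedFunctional ψ m (q ^ 2) := by
  have hq2 : natDegree (q ^ 2) ≤ 2 * m :=
    natDegree_pow_le.trans (Nat.mul_le_mul_left 2 hq)
  have hnn : 0 ≤ fun x ↦
      √(1 - x ^ 2) ^ (2 * m) * (q ^ 2).eval (x / √(1 - x ^ 2)) * (√(1 - x ^ 2))⁻¹ := fun x ↦ by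
    simp only [eval_pow, Pi.zero_apply]
    positivity
  rw [weightedFunctional_eq_integral hint _ hq2]
  refine lt_of_le_of_ne (integral_nonneg hnn) fun h0 ↦ hsupp ?_
  rw [eq_comm, integral_eq_zero_iff_of_nonneg hnn (integrable_weighted_eval hint _ hq2)] at h0
  -- `x / √(1 - x²) = t` is solved by `x = t / √(1 + t²)`
  set F : Set ℝ := (fun t ↦ t / √(1 + t ^ 2)) '' {t | q.eval t = 0} with hF
  have hFfin : F.Finite := by
    refine Set.Finite.image _ ((q.roots.toFinset.finite_toSet).subset fun t ht ↦ ?_)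
    simpa [hq0] using ht
  refine hFfin.subset (Measure.support_subset_of_isClosed hFfin.isClosed ?_)
  filter_upwards [h0, ae_one_sub_sq_pos hint] with x hx hpos
  have hs : 0 < √(1 - x ^ 2) := Real.sqrt_pos.2 hpos
  refine ⟨x / √(1 - x ^ 2), ?_, ?_⟩
  · simpa [hs.ne'] using hx
  · have h1 : 1 + (x / √(1 - x ^ 2)) ^ 2 = ((√(1 - x ^ 2))⁻¹) ^ 2 := by
      rw [div_pow, inv_pow, Real.sq_sqrt hpos.le]
      field_simp
      ring
    simp only
    rw [h1, Real.sqrt_sq (by positivity)]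
    field_simp

/-! ### The functions `Ŵ_m` in the variable `x / √(1 - x²)` -/

/-- The polynomials `p_m` with `Ŵ_m(x) = (1 - x²)^(m/2) p_m(x / √(1 - x²))`. -/
noncomputable def whatPoly (ψ : Measure ℝ) : ℕ → ℝ[X]
  | 0 => 1
  | 1 => X - C (betaHat ψ 1)
  | m + 2 => (X - C (betaHat ψ (m + 2))) * whatPoly ψ (m + 1)
      - C (alphaHat ψ (m + 2)) * (X ^ 2 + 1) * whatPoly ψ m

theorem What_eq_eval (ψ : Measure ℝ) {x : ℝ} (hx : 0 < 1 - x ^ 2) (m : ℕ) :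
    What ψ m x = √(1 - x ^ 2) ^ m * (whatPoly ψ m).eval (x / √(1 - x ^ 2)) := by
  have hs : √(1 - x ^ 2) ≠ 0 := (Real.sqrt_pos.2 hx).ne'
  have h1 : √(1 - x ^ 2) * (x / √(1 - x ^ 2)) = x := mul_div_cancel₀ _ hs
  have h2 : √(1 - x ^ 2) ^ 2 * ((x / √(1 - x ^ 2)) ^ 2 + 1) = 1 := by
    rw [mul_add, ← mul_pow, h1, Real.sq_sqrt hx.le]
    ring
  have key : ∀ m, What ψ m x = √(1 - x ^ 2) ^ m * (whatPoly ψ m).eval (x / √(1 - x ^ 2)) ∧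
      What ψ (m + 1) x =
        √(1 - x ^ 2) ^ (m + 1) * (whatPoly ψ (m + 1)).eval (x / √(1 - x ^ 2)) := by
    intro m
    induction m with
    | zero =>
      refine ⟨by simp [What_zero, whatPoly], ?_⟩
      rw [zero_add, What_one, whatPoly, eval_sub, eval_X, eval_C]
      linear_combination -h1
    | succ k ih =>
      refine ⟨ih.2, ?_⟩
      rw [What_succ ψ (k + 1) (by omega), Nat.add_sub_cancel, ih.1, ih.2]
      simp only [whatPoly, eval_sub, eval_mul, eval_X, eval_C, eval_add, eval_pow, eval_one]
      set s := √(1 - x ^ 2)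
      set t := x / s
      linear_combination
        (alphaHat ψ (k + 2) * s ^ k * (whatPoly ψ k).eval t) * h2
          - s ^ (k + 1) * (whatPoly ψ (k + 1)).eval t * h1
  exact (key m).1

theorem isRIIRecurrence_whatPoly (ψ : Measure ℝ) :
    IsRIIRecurrence (whatPoly ψ) (alphaHat ψ) (betaHat ψ) where
  p_zero := by rw [whatPoly]
  p_one := by rw [whatPoly]
  p_add_two m := by rw [whatPoly]

theorem rhoHat_eq {ψ : Measure ℝ}
    (hint : ∫⁻ x, ENNReal.ofReal (1 - x ^ 2) ^ (-(1 / 2) : ℝ) ∂ψ < ∞) (m : ℕ) :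
    rhoHat ψ m = weightedFunctional ψ (m + 1) (whatPoly ψ m ^ 2) := by
  have hd := (isRIIRecurrence_whatPoly ψ).natDegree_le m
  rw [weightedFunctional_eq_integral hint _ ((natDegree_pow_le_of_le 2 hd).trans (by omega))]
  refine integral_congr_ae ?_
  filter_upwards [ae_one_sub_sq_pos hint] with x hx
  have hs : √(1 - x ^ 2) ≠ 0 := (Real.sqrt_pos.2 hx).ne'
  rw [What_eq_eval ψ hx, eval_pow]
  field_simp
  ring

theorem rhoHat_pos {ψ : Measure ℝ} (hsupp : ψ.support.Infinite)
    (hint : ∫⁻ x, ENNReal.ofReal (1 - x ^ 2) ^ (-(1 / 2) : ℝ) ∂ψ < ∞) (m : ℕ) :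
    0 < rhoHat ψ m := by
  rw [rhoHat_eq hint]
  exact weightedFunctional_sq_pos hint hsupp _ ((isRIIRecurrence_whatPoly ψ).ne_zero m)
    (((isRIIRecurrence_whatPoly ψ).natDegree_le m).trans (Nat.le_succ m))

theorem integral_mul_What_sq {ψ : Measure ℝ}
    (hint : ∫⁻ x, ENNReal.ofReal (1 - x ^ 2) ^ (-(1 / 2) : ℝ) ∂ψ < ∞) (m : ℕ) :
    ∫ x, x * What ψ m x ^ 2 ∂ψ = weightedFunctional ψ (m + 1) (X * whatPoly ψ m ^ 2) := by
  have hd := (isRIIRecurrence_whatPoly ψ).natDegree_le m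
  rw [weightedFunctional_eq_integral hint _
    ((natDegree_mul_le_of_le natDegree_X_le (natDegree_pow_le_of_le 2 hd)).trans (by omega))]
  refine integral_congr_ae ?_
  filter_upwards [ae_one_sub_sq_pos hint] with x hx
  have hs : √(1 - x ^ 2) ≠ 0 := (Real.sqrt_pos.2 hx).ne'
  simp only [What_eq_eval ψ hx, eval_pow, eval_mul, eval_X]
  field_simp
  ring

theorem integral_mul_What_mul_What {ψ : Measure ℝ}
    (hint : ∫⁻ x, ENNReal.ofReal (1 - x ^ 2) ^ (-(1 / 2) : ℝ) ∂ψ < ∞) (m : ℕ) (b : ℝ) :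
    ∫ x, (x - b * √(1 - x ^ 2)) * What ψ m x * What ψ (m + 1) x * √(1 - x ^ 2) ∂ψ =
      weightedFunctional ψ (m + 2) ((X - C b) * whatPoly ψ m * whatPoly ψ (m + 1)) := by
  have hd := (isRIIRecurrence_whatPoly ψ).natDegree_le m
  have hd1 := (isRIIRecurrence_whatPoly ψ).natDegree_le (m + 1)
  rw [weightedFunctional_eq_integral hint _ ((natDegree_mul_le_of_le
    (natDegree_mul_le_of_le (natDegree_X_sub_C_le b) hd) hd1).trans (by omega))]
  refine integral_congr_ae ?_
  filter_upwards [ae_one_sub_sq_pos hint] with x hx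
  have hs : √(1 - x ^ 2) ≠ 0 := (Real.sqrt_pos.2 hx).ne'
  simp only [What_eq_eval ψ hx, eval_mul, eval_sub, eval_X, eval_C]
  field_simp
  ring

theorem isRIISystem_whatPoly {ψ : Measure ℝ} (hsupp : ψ.support.Infinite)
    (hint : ∫⁻ x, ENNReal.ofReal (1 - x ^ 2) ^ (-(1 / 2) : ℝ) ∂ψ < ∞) :
    IsRIISystem (weightedFunctional ψ) (whatPoly ψ) (alphaHat ψ) (betaHat ψ) where
  toIsRIIRecurrence := isRIIRecurrence_whatPoly ψ
  J_succ m _ hq := weightedFunctional_succ hint m hq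
  J_pos m _ hq0 hq := weightedFunctional_sq_pos hint hsupp m hq0 hq
  b_succ m := by
    have h := (rhoHat_pos hsupp hint m).ne'
    rw [← integral_mul_What_sq hint, ← rhoHat_eq hint, betaHat_succ]
    field_simp
  a_add_two m := by
    have h := (rhoHat_pos hsupp hint m).ne'
    rw [← integral_mul_What_mul_What hint, ← rhoHat_eq hint, alphaHat_succ ψ (m + 1) (by omega),
      Nat.add_sub_cancel]
    field_simp

theorem mainTheorem4 (ψ : Measure ℝ)
    (hψ : ψ (Icc (-1) 1)ᶜ = 0)
    (hsupp : ψ.support.Infinite)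
    (hint : ∫⁻ x, ENNReal.ofReal (1 - x ^ 2) ^ (-(1 / 2) : ℝ) ∂ψ < ∞) :
    -- the sequence with `n`-th term `α̂_{n+1}`, `n ≥ 1`, is a positive chain sequence
    IsPositiveChainSequence (fun n => alphaHat ψ (n + 1)) ∧
    -- its maximal and minimal parameter sequences are different
    (∃ m M : ℕ → ℝ,
      IsMinimalParameterSequence (fun n => alphaHat ψ (n + 1)) m ∧
      IsMaximalParameterSequence (fun n => alphaHat ψ (n + 1)) M ∧
      M ≠ m) ∧
    -- the same numbers are the coefficients of the recurrence of the polynomials `K̂_m`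
    (∃ K : ℕ → Polynomial ℂ,
      (∀ m : ℕ, ∀ θ ∈ Icc (0 : ℝ) (2 * Real.pi),
        Complex.exp (-(Complex.I * m * θ / 2)) * (K m).eval (Complex.exp (Complex.I * θ)) =
          2 ^ m * (What ψ m (Real.cos (θ / 2)) : ℂ)) ∧
      K 0 = 1 ∧
      K 1 = Polynomial.C (1 + Complex.I * betaHat ψ 1) * Polynomial.X
        + Polynomial.C (1 - Complex.I * betaHat ψ 1) ∧
      ∀ m : ℕ, 1 ≤ m →
        K (m + 1) =
          (Polynomial.C (1 + Complex.I * betaHat ψ (m + 1)) * Polynomial.X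
            + Polynomial.C (1 - Complex.I * betaHat ψ (m + 1))) * K m
          - Polynomial.C (4 * (alphaHat ψ (m + 1) : ℂ)) * Polynomial.X * K (m - 1)) := by
  obtain ⟨g, hg, hg0⟩ := (isRIISystem_whatPoly hsupp hint).exists_isParameterSequence
  obtain ⟨m, hm⟩ := exists_isMinimalParameterSequence hg
  obtain ⟨M, hM⟩ := exists_isMaximalParameterSequence hg
  refine ⟨⟨g, hg⟩, ⟨m, M, hm, hM, ?_⟩, circlePoly ψ, fun n θ hθ ↦ circlePoly_eval ψ hθ n,
    by rw [circlePoly], by rw [circlePoly], fun n hn ↦ ?_⟩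
  -- the initial value of `M` is at least `g 0 > 0`
  · rintro rfl
    exact absurd (hM.2 g hg 0) (by rw [hm.2]; exact not_le.2 hg0)
  · obtain ⟨k, rfl⟩ : ∃ k, n = k + 1 := ⟨n - 1, by omega⟩
    rw [circlePoly, Nat.add_sub_cancel]
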